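/- Let $\Omega$ be a set. A mechanism on $\Omega^n$ with responses in a measurable space $\mathcal R$ assigns to every dataset $\omega\in\Omega^n$ a probability law on $\mathcal R$ (the law of its random output $\mathcal M(\omega)$). It is $(\varepsilon,\delta)$-DP if $\mathbb P(\mathcal M(\omega)\in E)\le e^{\varepsilon}\,\mathbb P(\mathcal M(\omega')\in E)+\delta$ for all measurable $E\subseteq\mathcal R$ and all $\omega,\omega'\in\Omega^n$ that are identical except for one of their elements. Let $1\le m\le n$ and $1\le T\le\binom nm$ be integers, $\tau_n,\tau_m>0$, $\alpha\in(0,1)$, $\varepsilon,\varepsilon'\ge 0$ and $\delta,\delta'\in[0,1]$. Let $\mathcal M:\Omega^n\to\mathbb R$ be an $(\varepsilon,\delta)$-DP mechanism and $\mathcal M':\Omega^m\to\mathbb R$ an $(\varepsilon',\delta')$-DP mechanism. The algorithm $\mathtt{PrivSub}$ acts on $\omega\in\Omega^n$ as follows. It draws $\tilde\theta\sim\mathcal M(\omega)$ and, independently, for $i=1,\dots,T$ (independently over $i$) draws distinct indices $(I_1,\dots,I_m)$ from $\{1,\dots,n\}$ uniformly at random without replacement (so that $\{I_1,\dots,I_m\}$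 is a uniformly random $m$-subset, listed in uniformly random order) and then draws $\tilde\theta_i\sim\mathcal M'(\omega_{I_1},\dots,\omega_{I_m})$. With $\tilde\theta_{(1)}\le\dots\le\tilde\theta_{(T)}$ the sorted values of $\tilde\theta_1,\dots,\tilde\theta_T$, $\tilde\theta_{(0)}:=\tilde\theta_{(1)}$, $k_\ell=\lfloor(\alpha/2)T\rfloor$ and $k_u=\lceil(1-\alpha/2)T\rceil$, it returns the two endpoints of $$\Big[\tilde\theta-\tfrac{\tau_m}{\tau_n}\big(\tilde\theta-\tilde\theta_{(k_\ell)}\big),\ \tilde\theta+\tfrac{\tau_m}{\tau_n}\big(\tilde\theta_{(k_u)}-\tilde\theta\big)\Big].$$ Put $$\varepsilon_{\mathrm{amp}}=\log\Big(1+\frac mn\big(e^{\varepsilon'}-1\big)\Big),\qquad \delta_{\mathrm{amp}}=\frac mn\,\delta'.$$ Then $\mathtt{PrivSub}$ is $(T\varepsilon_{\mathrm{amp}}+\varepsilon,\ T\delta_{\mathrm{amp}}+\delta)$-DP. Moreover, for every $\delta''>0$ it is $(\varepsilon_t,\ T\delta_{\mathrm{amp}}+\delta''+\delta)$-DP, where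 $$\varepsilon_t=\varepsilon_{\mathrm{amp}}\left(\sqrt{2T\log(1/\delta'')}+T\,\frac{e^{\varepsilon_{\mathrm{amp}}}-1}{e^{\varepsilon_{\mathrm{amp}}}+1}\right)+\varepsilon,$$ the square root being read as $0$ if $\delta''>1$. -/

import Mathlib

open MeasureTheory

noncomputable section

namespace PrivCI

/-- A randomized mechanism on datasets of size `n` over `Ω` with responses in `R`: every dataset is
sent to the law of the response. -/
abbrev Mechanism (Ω : Type*) (n : ℕ) (R : Type*) [MeasurableSpace R] :=
  (Fin n → Ω) → ProbabilityMeasure R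

/-- Neighbouring datasets: identical except (possibly) in one of their elements. -/
def Neighbors {Ω : Type*} {n : ℕ} (ω ω' : Fin n → Ω) : Prop :=
  ∃ j : Fin n, ∀ i : Fin n, i ≠ j → ω i = ω' i

/-- `(ε, δ)`-differential privacy. -/
def IsDP {Ω : Type*} {n : ℕ} {R : Type*} [MeasurableSpace R]
    (M : Mechanism Ω n R) (ε δ : ℝ) : Prop :=
  ∀ ω ω' : Fin n → Ω, Neighbors ω ω' → ∀ E : Set R, MeasurableSet E →
    (M ω : Measure R).real E ≤ Real.exp ε * (M ω' : Measure R).real E + δ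

/-- Draw `m` distinct indices `I = (I₁, …, I_m)` of `{1, …, n}` uniformly at random (sampling
without replacement) and apply `M` to `ω(I) = (ω_{I₁}, …, ω_{I_m})`. The index tuples are the
injections `Fin m ↪ Fin n`; the law of the output is the uniform mixture over them. -/
def subsampled {Ω : Type*} {n m : ℕ} {R : Type*} [MeasurableSpace R] (hmn : m ≤ n)
    (M : Mechanism Ω m R) : Mechanism Ω n R := fun ω =>
  ⟨(Fintype.card (Fin m ↪ Fin n) : ENNReal)⁻¹ •
      ∑ I : Fin m ↪ Fin n, (M (ω ∘ I) : Measure R), by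
    have hne : Nonempty (Fin m ↪ Fin n) := ⟨Fin.castLEEmb hmn⟩
    constructor
    simp only [Measure.smul_apply, Measure.coe_finsetSum, Finset.sum_apply, measure_univ,
      Finset.sum_const, Finset.card_univ, nsmul_eq_mul, mul_one, smul_eq_mul]
    exact ENNReal.inv_mul_cancel (by exact_mod_cast Fintype.card_ne_zero)
      (ENNReal.natCast_ne_top _)⟩

/-- The order statistic `θ_(k)`, `1 ≤ k ≤ T`, of `θ₁, …, θ_T` (so `θ_(1) ≤ ⋯ ≤ θ_(T)`), with the
convention `θ_(0) = θ_(1)`. -/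
def orderStat {T : ℕ} (hT : 1 ≤ T) (θ : Fin T → ℝ) (k : ℕ) : ℝ :=
  θ (Tuple.sort θ ⟨min (k - 1) (T - 1), by omega⟩)

/-- The endpoints of the interval
`[θ₀ - (τm/τn) (θ₀ - θ_(kℓ)), θ₀ + (τm/τn) (θ_(ku) - θ₀)]`, where `kℓ = ⌊(α/2) T⌋` and
`ku = ⌈(1 - α/2) T⌉`, as a function of `x = (θ₀, (θ₁, …, θ_T))`. -/
def interval {T : ℕ} (hT : 1 ≤ T) (τn τm α : ℝ) (x : ℝ × (Fin T → ℝ)) : ℝ × ℝ :=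
  (x.1 - τm / τn * (x.1 - orderStat hT x.2 ⌊α / 2 * T⌋₊),
   x.1 + τm / τn * (orderStat hT x.2 ⌈(1 - α / 2) * T⌉₊ - x.1))

theorem measurable_sort (T : ℕ) :
    Measurable[_, ⊤] (fun θ : Fin T → ℝ => Tuple.sort θ) := by
  let _ : MeasurableSpace (Equiv.Perm (Fin T)) := ⊤
  have : MeasurableSingletonClass (Equiv.Perm (Fin T)) := ⟨fun _ => trivial⟩
  refine measurable_to_countable' fun σ => ?_
  have h : (fun θ : Fin T → ℝ => Tuple.sort θ) ⁻¹' {σ} =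
      {θ | (∀ i j, i ≤ j → θ (σ i) ≤ θ (σ j)) ∧
        ∀ i j, i < j → θ (σ i) = θ (σ j) → σ i < σ j} := by
    ext θ
    simp only [Set.mem_preimage, Set.mem_singleton_iff, Set.mem_ofPred_eq]
    rw [eq_comm, Tuple.eq_sort_iff]
    rfl
  rw [h]
  measurability

theorem measurable_orderStat {T : ℕ} (hT : 1 ≤ T) (k : ℕ) :
    Measurable fun θ : Fin T → ℝ => orderStat hT θ k := by
  let _ : MeasurableSpace (Equiv.Perm (Fin T)) := ⊤
  have : MeasurableSingletonClass (Equiv.Perm (Fin T)) := ⟨fun _ => trivial⟩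
  have h : Measurable fun p : (Fin T → ℝ) × Equiv.Perm (Fin T) =>
      p.1 (p.2 ⟨min (k - 1) (T - 1), by omega⟩) :=
    measurable_from_prod_countable_left fun σ =>
      measurable_pi_apply (σ ⟨min (k - 1) (T - 1), by omega⟩)
  exact h.comp (measurable_id.prodMk (measurable_sort T))

theorem measurable_interval {T : ℕ} (hT : 1 ≤ T) (τn τm α : ℝ) :
    Measurable (interval hT τn τm α) := by
  have h1 := (measurable_orderStat hT ⌊α / 2 * T⌋₊).comp (measurable_snd : Measurable (Prod.snd : ℝ × (Fin T → ℝ) → _))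
  have h2 := (measurable_orderStat hT ⌈(1 - α / 2) * T⌉₊).comp (measurable_snd : Measurable (Prod.snd : ℝ × (Fin T → ℝ) → _))
  exact (measurable_fst.sub ((measurable_fst.sub h1).const_mul _)).prodMk
    (measurable_fst.add ((h2.sub measurable_fst).const_mul _))

/-- The `PrivSub` algorithm. It computes `θ₀` by `M` on the full dataset and, independently,
`θ₁, …, θ_T` by `T` independent runs of: draw a fresh subsample of size `m` without replacement and
apply `M'` to it. It returns (the endpoints of) the interval computed from these numbers. -/
def privSub {Ω : Type*} {n m T : ℕ} (hmn : m ≤ n) (hT : 1 ≤ T) (τn τm α : ℝ)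
    (M : Mechanism Ω n ℝ) (M' : Mechanism Ω m ℝ) : Mechanism Ω n (ℝ × ℝ) := fun ω =>
  ((M ω).prod (ProbabilityMeasure.pi fun _ : Fin T => subsampled hmn M' ω)).map
    (measurable_interval hT τn τm α).aemeasurable

/-- `ε_amp = log (1 + (m/n) (e^ε' - 1))`. -/
def epsAmp (n m : ℕ) (ε' : ℝ) : ℝ := Real.log (1 + (m : ℝ) / n * (Real.exp ε' - 1))

/-- `δ_amp = (m/n) δ'`. -/
def deltaAmp (n m : ℕ) (δ' : ℝ) : ℝ := (m : ℝ) / n * δ'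

/-- `ε_t = ε_amp (√(2 T log (1/δ'')) + T (e^ε_amp - 1) / (e^ε_amp + 1)) + ε`. -/
def epsTotal (n m T : ℕ) (ε ε' δ'' : ℝ) : ℝ :=
  epsAmp n m ε' * (Real.sqrt (2 * T * Real.log (1 / δ'')) +
    T * ((Real.exp (epsAmp n m ε') - 1) / (Real.exp (epsAmp n m ε') + 1))) + ε

end PrivCI

end

/-!
`PrivSub` is a post-processing of `T + 1` independent mechanisms: `M` on the full dataset and `T`
runs of the subsampled mechanism. Its privacy follows from amplification by subsampling, from
composition of the `T` identical runs, and from one further basic composition with `M`.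

**Amplification** (`IsDP.subsampled`). Let `j` be the index where the two datasets differ. A random
tuple contains `j` with probability `m / n`, and tuples that avoid `j` see no difference. For the
tuples through `j` there are two comparisons, each with factor `exp ε'` and error `δ'`: keep the
tuple and change the dataset, or keep the dataset and replace `j` in the tuple by an unsampled
index. So their average response probability is controlled by the smaller of two averages, hence by
any mixture of the two, in particular by the response probability of the subsampled mechanism on
the other dataset.

**Composition** (`Indist.pi`, `Indist.pi_advanced`). If `P` and `Q` are mutually
`(ε, δ)`-indistinguishable with densities `f` and `g`, then `exists_pure_parts` provides `u ≤ f` and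
`v ≤ g` with `exp (-ε) ≤ u / v ≤ exp ε`, at least `1 - δ` of the mass of `P` remaining in `u`.
Passing from `f` to `u` in each of `T` factors costs `T * δ`. For the truncated densities the product
likelihood ratio is at most `exp (T * ε)`, which is basic composition. Advanced composition is the
Chernoff method: since `r ↦ r ^ (1 + l)` is convex, it lies below its chord over
`[exp (-ε), exp ε]`, so the moment `∫ v * (u / v) ^ (1 + l)` is at most its value for binary
randomized response, and Hoeffding's lemma for that two-valued privacy loss, whose mean is
`ε * (exp ε - 1) / (exp ε + 1)`, gives the stated bound.

**Composition with `M`** (`Indist.prod`) holds for arbitrary pairs of independent mechanisms.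
-/

namespace PrivCI

/-! ### Moments of likelihood ratios and randomized response -/

/-- Hoeffding's lemma for a `±1`-valued variable that takes the value `1` with probability `q`. -/
theorem two_point_mgf_le (q x : ℝ) (hq0 : 0 ≤ q) (hq1 : q ≤ 1) :
    q * Real.exp x + (1 - q) * Real.exp (-x) ≤ Real.exp (x * (2 * q - 1) + x ^ 2 / 2) := by
  let μ : Measure ℝ := ENNReal.ofReal q • Measure.dirac 1 +
    ENNReal.ofReal (1 - q) • Measure.dirac (-1)
  have hμ : IsProbabilityMeasure μ := by
    constructor
    simp only [μ, Measure.add_apply, Measure.smul_apply, measure_univ, smul_eq_mul, mul_one]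
    rw [← ENNReal.ofReal_add hq0 (by linarith)]
    simp
  have hint : ∀ f : ℝ → ℝ, ∫ y, f y ∂μ = q * f 1 + (1 - q) * f (-1) := by
    intro f
    rw [integral_add_measure, integral_smul_measure, integral_smul_measure, integral_dirac,
      integral_dirac, ENNReal.toReal_ofReal hq0, ENNReal.toReal_ofReal (by linarith)]
    · simp
    · exact (integrable_dirac (by simp)).smul_measure (by simp)
    · exact (integrable_dirac (by simp)).smul_measure (by simp)
  have hb : ∀ᵐ y ∂μ, y ∈ Set.Icc (-1 : ℝ) 1 := by
    simp only [μ, ae_add_measure_iff]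
    constructor
    · exact Measure.ae_smul_measure ((ae_dirac_iff measurableSet_Icc).2 (by simp)) _
    · exact Measure.ae_smul_measure ((ae_dirac_iff measurableSet_Icc).2 (by simp)) _
  have h := (ProbabilityTheory.hasSubgaussianMGF_of_mem_Icc (X := id) aemeasurable_id hb).mgf_le x
  simp only [ProbabilityTheory.mgf, id, hint] at h
  have h2 : (((‖(1 : ℝ) - -1‖₊ / 2) ^ 2 : NNReal) : ℝ) = 1 := by
    push_cast
    norm_num
  rw [h2] at h
  calc q * Real.exp x + (1 - q) * Real.exp (-x)
      = Real.exp (x * (2 * q - 1)) * (q * Real.exp (x * (1 - (q * 1 + (1 - q) * -1))) +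
          (1 - q) * Real.exp (x * (-1 - (q * 1 + (1 - q) * -1)))) := by
        rw [mul_add, mul_left_comm, ← Real.exp_add, mul_left_comm _ (1 - q), ← Real.exp_add]
        congr 3 <;> ring_nf
    _ ≤ Real.exp (x * (2 * q - 1)) * Real.exp (1 * x ^ 2 / 2) := by gcongr
    _ = _ := by rw [← Real.exp_add]; ring_nf

/-- The chord over `[a⁻¹, a]` of the convex function `r ↦ r ^ p`, at `r = u / v`, multiplied by `v`.
It is linear in `(u, v)`, and meaningful without division by `v`, so it commutes with integration
of densities `u` and `v`. -/
noncomputable def rpowChord (a p u v : ℝ) : ℝ :=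
  ((a * v - u) * a⁻¹ ^ p + (u - a⁻¹ * v) * a ^ p) / (a - a⁻¹)

theorem mul_rpow_div_le_rpowChord {a p u v : ℝ} (ha : 1 < a) (hp : 1 ≤ p) (hv : 0 < v)
    (huv : u ≤ a * v) (hvu : v ≤ a * u) : v * (u / v) ^ p ≤ rpowChord a p u v := by
  have ha0 : 0 < a := by linarith
  have hD : 0 < a - a⁻¹ := by
    have := inv_lt_one_of_one_lt₀ ha
    linarith
  have hvu' : a⁻¹ * v ≤ u := by rwa [inv_mul_le_iff₀ ha0]
  have h := (convexOn_rpow hp).2 (Set.mem_Ici.2 (inv_pos.2 ha0).le) (Set.mem_Ici.2 ha0.le)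
    (div_nonneg (b := a - a⁻¹) (a := a - u / v)
      (by rw [sub_nonneg, div_le_iff₀ hv]; exact huv) hD.le)
    (div_nonneg (b := a - a⁻¹) (a := u / v - a⁻¹)
      (by rw [sub_nonneg, le_div_iff₀ hv]; exact hvu') hD.le)
    (by rw [← add_div]; simp [div_self hD.ne'])
  have hr : ((a - u / v) / (a - a⁻¹)) • a⁻¹ + ((u / v - a⁻¹) / (a - a⁻¹)) • a = u / v := by
    simp only [smul_eq_mul]
    rw [div_mul_eq_mul_div, div_mul_eq_mul_div, ← add_div, div_eq_iff hD.ne']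
    ring
  rw [hr] at h
  calc v * (u / v) ^ p ≤ v * _ := mul_le_mul_of_nonneg_left h hv.le
    _ = rpowChord a p u v := by
      simp only [smul_eq_mul, rpowChord]
      field_simp

theorem rpowChord_nonneg {a p u v : ℝ} (ha : 1 < a) (huv : u ≤ a * v) (hvu : v ≤ a * u) :
    0 ≤ rpowChord a p u v := by
  have ha0 : 0 < a := by linarith
  have hvu' : a⁻¹ * v ≤ u := by rwa [inv_mul_le_iff₀ ha0]
  have := inv_lt_one_of_one_lt₀ ha
  exact div_nonneg (add_nonneg (mul_nonneg (by linarith) (by positivity))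
    (mul_nonneg (by linarith) (by positivity))) (by linarith)

/-- For `p ≥ 1` the chord of `r ↦ r ^ p` meets the vertical axis at or below `0`; hence adding mass
to `v` only lowers `rpowChord`. -/
theorem rpowChord_antitone {a p u v v' : ℝ} (ha : 1 < a) (hp : 1 ≤ p) (h : v ≤ v') :
    rpowChord a p u v' ≤ rpowChord a p u v := by
  have ha0 : 0 < a := by linarith
  have h1 := inv_lt_one_of_one_lt₀ ha
  have e1 : a * a⁻¹ ^ p ≤ 1 := by
    calc a * a⁻¹ ^ p ≤ a * a⁻¹ ^ (1 : ℝ) := by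
          gcongr ?_ * ?_
          exact Real.rpow_le_rpow_of_exponent_ge (by positivity) h1.le hp
      _ = 1 := by rw [Real.rpow_one, mul_inv_cancel₀ ha0.ne']
  have e2 : 1 ≤ a⁻¹ * a ^ p := by
    calc (1 : ℝ) = a⁻¹ * a ^ (1 : ℝ) := by rw [Real.rpow_one, inv_mul_cancel₀ ha0.ne']
      _ ≤ _ := by
          gcongr ?_ * ?_
          exact Real.rpow_le_rpow_of_exponent_le ha.le hp
  unfold rpowChord
  refine div_le_div_of_nonneg_right ?_ (by linarith)
  nlinarith [mul_nonneg (sub_nonneg.2 h) (sub_nonneg.2 (e1.trans e2))]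

/-- `rpowChord (exp ε) (1 + l) 1 1` is the moment generating function at `l` of the privacy loss of
binary randomized response, that is, of the variable equal to `ε` with probability
`exp ε / (exp ε + 1)` and to `-ε` otherwise. -/
theorem rpowChord_exp_one_one_le {ε l : ℝ} (hε : 0 < ε) :
    rpowChord (Real.exp ε) (1 + l) 1 1 ≤
      Real.exp (l * ε * ((Real.exp ε - 1) / (Real.exp ε + 1)) + (l * ε) ^ 2 / 2) := by
  have ha : 1 < Real.exp ε := Real.one_lt_exp_iff.2 hε
  have h := two_point_mgf_le (Real.exp ε / (Real.exp ε + 1)) (l * ε) (by positivity)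
    (by rw [div_le_one (by positivity)]; linarith)
  refine le_of_eq_of_le ?_ (h.trans_eq ?_)
  · have e1 : Real.exp ε ^ (1 + l) = Real.exp ε * Real.exp (l * ε) := by
      rw [← Real.exp_mul, ← Real.exp_add]; ring_nf
    have e2 : (Real.exp ε)⁻¹ ^ (1 + l) = (Real.exp ε)⁻¹ * Real.exp (-(l * ε)) := by
      rw [← Real.exp_neg, ← Real.exp_mul, ← Real.exp_add]; ring_nf
    rw [rpowChord, e1, e2]
    generalize Real.exp (l * ε) = X
    generalize Real.exp (-(l * ε)) = Y
    generalize Real.exp ε = a at ha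
    have h1 : a ≠ 0 := by linarith
    have h2 : a + 1 ≠ 0 := by linarith
    have h3 : a ^ 2 - 1 ≠ 0 := by nlinarith
    have h4 : a - a⁻¹ ≠ 0 := by
      have := inv_lt_one_of_one_lt₀ ha
      linarith
    rw [div_eq_iff h4]
    field_simp
    ring
  · congr 3
    field_simp
    ring

/-- The Chernoff bound for the product likelihood ratio `R = ∏ u / v`, in pointwise form: either
`R ≤ exp c`, or `R ≤ R * (R / exp c) ^ l`, and the chord bounds each factor of `R ^ (1 + l)`. -/
theorem prod_le_exp_mul_prod_add {ι : Type*} [Fintype ι] {a l c : ℝ} (ha : 1 < a) (hl : 0 ≤ l)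
    {u v : ι → ℝ} (hu : ∀ i, 0 ≤ u i) (huv : ∀ i, u i ≤ a * v i)
    (hvu : ∀ i, v i ≤ a * u i) :
    ∏ i, u i ≤ Real.exp c * ∏ i, v i +
      Real.exp (-(l * c)) * ∏ i, rpowChord a (1 + l) (u i) (v i) := by
  have ha0 : 0 < a := by linarith
  have hv : ∀ i, 0 ≤ v i := fun i => by
    have := (hu i).trans (huv i)
    exact nonneg_of_mul_nonneg_right this ha0
  have hw : 0 ≤ ∏ i, rpowChord a (1 + l) (u i) (v i) :=
    Finset.prod_nonneg fun i _ => rpowChord_nonneg ha (huv i) (hvu i)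
  have hV : 0 ≤ ∏ i, v i := Finset.prod_nonneg fun i _ => hv i
  -- If some `v i` vanishes then so does `u i`, and the left-hand side is `0`.
  by_cases hz : ∏ i, v i = 0
  · obtain ⟨i, -, hi⟩ := Finset.prod_eq_zero_iff.1 hz
    have : u i = 0 := le_antisymm (by simpa [hi] using huv i) (hu i)
    rw [Finset.prod_eq_zero (Finset.mem_univ i) this]
    positivity
  have hvpos : ∀ i, 0 < v i := fun i =>
    lt_of_le_of_ne (hv i) fun h => hz (Finset.prod_eq_zero (Finset.mem_univ i) h.symm)
  set R := ∏ i, u i / v i with hR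
  have hR0 : 0 ≤ R := Finset.prod_nonneg fun i _ => div_nonneg (hu i) (hv i)
  have hU : ∏ i, u i = (∏ i, v i) * R := by
    rw [hR, ← Finset.prod_mul_distrib]
    exact Finset.prod_congr rfl fun i _ => (mul_div_cancel₀ _ (hvpos i).ne').symm
  have hW : (∏ i, v i) * R ^ (1 + l) ≤ ∏ i, rpowChord a (1 + l) (u i) (v i) := by
    rw [hR, ← Real.finsetProd_rpow _ _ fun i _ => div_nonneg (hu i) (hv i),
      ← Finset.prod_mul_distrib]
    refine Finset.prod_le_prod (fun i _ => mul_nonneg (hv i) ?_) fun i _ =>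
      mul_rpow_div_le_rpowChord ha (by linarith) (hvpos i) (huv i) (hvu i)
    exact Real.rpow_nonneg (div_nonneg (hu i) (hv i)) _
  rcases le_or_gt R (Real.exp c) with h | h
  · rw [hU, mul_comm]
    have := mul_le_mul_of_nonneg_right h hV
    have h0 : 0 ≤ Real.exp (-(l * c)) * ∏ i, rpowChord a (1 + l) (u i) (v i) := by positivity
    linarith
  · have hRpos : 0 < R := (Real.exp_pos c).trans h
    have h1 : 1 ≤ Real.exp (-(l * c)) * R ^ l := by
      have : Real.exp c ^ l ≤ R ^ l := Real.rpow_le_rpow (Real.exp_pos c).le h.le hl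
      rw [← Real.exp_mul] at this
      calc (1 : ℝ) = Real.exp (-(l * c)) * Real.exp (c * l) := by
            rw [← Real.exp_add, ← Real.exp_zero]; ring_nf
        _ ≤ _ := by gcongr
    calc ∏ i, u i = (∏ i, v i) * R * 1 := by rw [hU, mul_one]
      _ ≤ (∏ i, v i) * R * (Real.exp (-(l * c)) * R ^ l) := by gcongr
      _ = Real.exp (-(l * c)) * ((∏ i, v i) * R ^ (1 + l)) := by
        rw [Real.rpow_add hRpos, Real.rpow_one]; ring
      _ ≤ Real.exp (-(l * c)) * ∏ i, rpowChord a (1 + l) (u i) (v i) := by gcongr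
      _ ≤ _ := le_add_of_nonneg_left (by positivity)

/-! ### Indistinguishability, densities and composition -/

variable {X Y : Type*} [MeasurableSpace X] [MeasurableSpace Y]

/-- One-sided `(ε, δ)`-indistinguishability of two laws: `P E ≤ exp ε * Q E + δ` for all measurable
`E`. A mechanism is differentially private when its laws on neighbouring datasets satisfy this. -/
def Indist (P Q : Measure X) (ε δ : ℝ) : Prop :=
  ∀ E : Set X, MeasurableSet E → P.real E ≤ Real.exp ε * Q.real E + δ

/-- `f` is a measurable, nonnegative, integrable, real-valued density of `P` with respect to `μ`. -/
structure IsDensity (P μ : Measure X) (f : X → ℝ) : Prop where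
  measurable : Measurable f
  nonneg : ∀ x, 0 ≤ f x
  integrable : Integrable f μ
  eq_withDensity : P = μ.withDensity fun x => ENNReal.ofReal (f x)

theorem exists_isDensity (P μ : Measure X) [IsFiniteMeasure P] [IsFiniteMeasure μ] (h : P ≪ μ) :
    ∃ f, IsDensity P μ f := by
  refine ⟨fun x => (P.rnDeriv μ x).toReal, (Measure.measurable_rnDeriv P μ).ennreal_toReal,
    fun x => ENNReal.toReal_nonneg, Measure.integrable_toReal_rnDeriv, ?_⟩
  conv_lhs => rw [← Measure.withDensity_rnDeriv_eq P μ h]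
  refine withDensity_congr_ae ?_
  filter_upwards [Measure.rnDeriv_lt_top P μ] with x hx
  rw [ENNReal.ofReal_toReal hx.ne]

namespace IsDensity

variable {P μ : Measure X} {f : X → ℝ}

theorem real_apply (h : IsDensity P μ f) {E : Set X} (hE : MeasurableSet E) :
    P.real E = ∫ x in E, f x ∂μ := by
  rw [measureReal_def, h.eq_withDensity, withDensity_apply _ hE,
    integral_eq_lintegral_of_nonneg_ae (Filter.Eventually.of_forall h.nonneg)
      h.measurable.aestronglyMeasurable]

theorem integral_eq_one [IsProbabilityMeasure P] (h : IsDensity P μ f) : ∫ x, f x ∂μ = 1 := by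
  rw [← setIntegral_univ, ← h.real_apply MeasurableSet.univ, probReal_univ]

theorem integral_eq (h : IsDensity P μ f) (φ : X → ℝ) :
    ∫ x, φ x ∂P = ∫ x, f x * φ x ∂μ := by
  rw [h.eq_withDensity, integral_withDensity_eq_integral_toReal_smul
    h.measurable.ennreal_ofReal (by simp)]
  simp [ENNReal.toReal_ofReal (h.nonneg _)]

theorem pi {ι : Type*} [Fintype ι] [IsFiniteMeasure P] [IsFiniteMeasure μ] (h : IsDensity P μ f) :
    IsDensity (Measure.pi fun _ : ι => P) (Measure.pi fun _ : ι => μ)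
      fun x => ∏ i, f (x i) where
  measurable := Finset.measurable_fun_prod _ fun i _ => h.measurable.comp (measurable_pi_apply i)
  nonneg x := Finset.prod_nonneg fun i _ => h.nonneg _
  integrable := Integrable.fintype_prod fun _ => h.integrable
  eq_withDensity := by
    refine Measure.pi_eq fun s hs => ?_
    rw [withDensity_apply _ (MeasurableSet.univ_pi hs), Measure.restrict_pi_pi,
      ← ofReal_integral_eq_lintegral_ofReal, integral_fintype_prod_eq_prod,
      ENNReal.ofReal_prod_of_nonneg]
    · refine Finset.prod_congr rfl fun i _ => ?_
      rw [← h.real_apply (hs i), ofReal_measureReal]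
    · exact fun i _ => integral_nonneg h.nonneg
    · exact Integrable.fintype_prod fun i => h.integrable.restrict
    · exact Filter.Eventually.of_forall fun x => Finset.prod_nonneg fun i _ => h.nonneg _

end IsDensity

theorem exists_common_density (P Q : Measure X) [IsFiniteMeasure P] [IsFiniteMeasure Q] :
    ∃ (μ : Measure X) (f g : X → ℝ), IsFiniteMeasure μ ∧ IsDensity P μ f ∧ IsDensity Q μ g := by
  obtain ⟨f, hf⟩ := exists_isDensity P (P + Q) (Measure.le_add_right le_rfl).absolutelyContinuous
  obtain ⟨g, hg⟩ := exists_isDensity Q (P + Q) (Measure.le_add_left le_rfl).absolutelyContinuous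
  exact ⟨P + Q, f, g, inferInstance, hf, hg⟩

/-- Indistinguishability passes from events to `[0, 1]`-valued test functions, because
`∫ φ dP - exp ε * ∫ φ dQ` is largest for the indicator of `{dP > exp ε * dQ}`. -/
theorem Indist.integral_le {P Q : Measure X} [IsProbabilityMeasure P] [IsProbabilityMeasure Q]
    {ε δ : ℝ} (h : Indist P Q ε δ) {φ : X → ℝ} (hφ : Measurable φ) (h0 : ∀ x, 0 ≤ φ x)
    (h1 : ∀ x, φ x ≤ 1) : ∫ x, φ x ∂P ≤ Real.exp ε * ∫ x, φ x ∂Q + δ := by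
  obtain ⟨μ, f, g, hμ, hf, hg⟩ := exists_common_density P Q
  have hb : ∀ x, ‖φ x‖ ≤ 1 := fun x => by rw [Real.norm_of_nonneg (h0 x)]; exact h1 x
  have hif : Integrable (fun x => f x * φ x) μ :=
    hf.integrable.mul_bdd hφ.aestronglyMeasurable (Filter.Eventually.of_forall hb)
  have hig : Integrable (fun x => g x * φ x) μ :=
    hg.integrable.mul_bdd hφ.aestronglyMeasurable (Filter.Eventually.of_forall hb)
  set S : Set X := {x | Real.exp ε * g x < f x} with hS
  have hSm : MeasurableSet S := measurableSet_lt (hg.measurable.const_mul _) hf.measurable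
  have hd : Integrable (fun x => f x - Real.exp ε * g x) μ :=
    hf.integrable.sub (hg.integrable.const_mul _)
  have key : ∫ x, (f x * φ x - Real.exp ε * (g x * φ x)) ∂μ ≤
      ∫ x in S, (f x - Real.exp ε * g x) ∂μ := by
    rw [← integral_indicator hSm]
    refine integral_mono (hif.sub (hig.const_mul _)) (hd.indicator hSm) fun x => ?_
    by_cases hx : x ∈ S
    · rw [Set.indicator_of_mem hx]
      have hx' : Real.exp ε * g x < f x := hx
      nlinarith [h0 x, h1 x]
    · rw [Set.indicator_of_notMem hx]
      have hx' : f x ≤ Real.exp ε * g x := not_lt.1 hx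
      nlinarith [h0 x, h1 x]
  rw [integral_sub hif (hig.const_mul _), integral_const_mul,
    integral_sub hf.integrable.integrableOn (hg.integrable.const_mul _).integrableOn,
    integral_const_mul, ← hf.integral_eq, ← hg.integral_eq, ← hf.real_apply hSm,
    ← hg.real_apply hSm] at key
  linarith [h S hSm]

/-- Basic composition of two independent mechanisms. The section probabilities under `P'` are at
most `φ + δ'` with `φ ≤ 1` the truncation of `exp ε' * Q'`; the truncation is what makes the
errors add up without a factor `exp ε'`. -/
theorem Indist.prod {P Q : Measure X} {P' Q' : Measure Y} [IsProbabilityMeasure P]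
    [IsProbabilityMeasure Q] [IsProbabilityMeasure P'] [IsProbabilityMeasure Q'] {ε δ ε' δ' : ℝ}
    (h : Indist P Q ε δ) (h' : Indist P' Q' ε' δ') (hδ' : 0 ≤ δ') :
    Indist (P.prod P') (Q.prod Q') (ε' + ε) (δ' + δ) := by
  intro E hE
  have hP : Measurable fun x => P'.real (Prod.mk x ⁻¹' E) :=
    (measurable_measure_prodMk_left hE).ennreal_toReal
  have hQ : Measurable fun x => Q'.real (Prod.mk x ⁻¹' E) :=
    (measurable_measure_prodMk_left hE).ennreal_toReal
  have hQi : ∀ R : Measure X, IsProbabilityMeasure R →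
      Integrable (fun x => Q'.real (Prod.mk x ⁻¹' E)) R := fun R _ =>
    Integrable.of_mem_Icc 0 1 hQ.aemeasurable (Filter.Eventually.of_forall fun x =>
      ⟨measureReal_nonneg, measureReal_le_one⟩)
  set φ : X → ℝ := fun x => min 1 (Real.exp ε' * Q'.real (Prod.mk x ⁻¹' E)) with hφ
  have hφm : Measurable φ := measurable_const.min (hQ.const_mul _)
  have hφ0 : ∀ x, 0 ≤ φ x := fun x =>
    le_min zero_le_one (mul_nonneg (Real.exp_pos _).le measureReal_nonneg)
  have hφ1 : ∀ x, φ x ≤ 1 := fun x => min_le_left _ _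
  have hφi : ∀ R : Measure X, IsProbabilityMeasure R → Integrable φ R := fun R _ =>
    Integrable.of_mem_Icc 0 1 hφm.aemeasurable (Filter.Eventually.of_forall fun x =>
      ⟨hφ0 x, hφ1 x⟩)
  have hreal : ∀ (ν : Measure X) (ν' : Measure Y), IsProbabilityMeasure ν →
      IsProbabilityMeasure ν' →
      (ν.prod ν').real E = ∫ x, ν'.real (Prod.mk x ⁻¹' E) ∂ν := by
    intro ν ν' _ _
    rw [measureReal_def, Measure.prod_apply hE, ← integral_toReal
      (measurable_measure_prodMk_left hE).aemeasurable
      (Filter.Eventually.of_forall fun x => measure_lt_top _ _)]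
    rfl
  rw [hreal _ _ inferInstance inferInstance, hreal _ _ inferInstance inferInstance]
  calc ∫ x, P'.real (Prod.mk x ⁻¹' E) ∂P ≤ ∫ x, (φ x + δ') ∂P := by
        refine integral_mono (Integrable.of_mem_Icc 0 1 hP.aemeasurable
          (Filter.Eventually.of_forall fun x => ⟨measureReal_nonneg, measureReal_le_one⟩))
          ((hφi P inferInstance).add (integrable_const _)) fun x => ?_
        simp only [hφ, ← min_add_add_right]
        refine le_min ?_ (h' _ (measurable_prodMk_left hE))
        have : P'.real (Prod.mk x ⁻¹' E) ≤ 1 := measureReal_le_one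
        linarith
    _ = ∫ x, φ x ∂P + δ' := by
        rw [integral_add (hφi P inferInstance) (integrable_const _)]; simp
    _ ≤ Real.exp ε * ∫ x, φ x ∂Q + δ + δ' := by
        gcongr
        exact h.integral_le hφm hφ0 hφ1
    _ ≤ Real.exp ε * ∫ x, Real.exp ε' * Q'.real (Prod.mk x ⁻¹' E) ∂Q + δ + δ' := by
        gcongr ?_ * ?_ + _ + _
        exact integral_mono (hφi Q inferInstance) ((hQi Q inferInstance).const_mul _)
          fun x => min_le_right _ _
    _ = _ := by
        rw [integral_const_mul, Real.exp_add]; ring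

/-- Post-processing. -/
theorem Indist.map {P Q : Measure X} {ε δ : ℝ} (h : Indist P Q ε δ) {φ : X → Y}
    (hφ : Measurable φ) : Indist (P.map φ) (Q.map φ) ε δ := by
  intro E hE
  rw [map_measureReal_apply hφ hE, map_measureReal_apply hφ hE]
  exact h _ (hφ hE)

/-- The part of `P` that is dominated by `exp ε * Q` carries all but `δ` of the mass. -/
theorem Indist.one_sub_le_integral_min {P Q μ : Measure X} [IsProbabilityMeasure P] {f g : X → ℝ}
    {ε δ : ℝ} (h : Indist P Q ε δ) (hf : IsDensity P μ f) (hg : IsDensity Q μ g) :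
    1 - δ ≤ ∫ x, min (f x) (Real.exp ε * g x) ∂μ := by
  set S : Set X := {x | Real.exp ε * g x < f x} with hS
  have hSm : MeasurableSet S := measurableSet_lt (hg.measurable.const_mul _) hf.measurable
  have hi : Integrable (fun x => min (f x) (Real.exp ε * g x)) μ :=
    hf.integrable.inf (hg.integrable.const_mul _)
  rw [← integral_add_compl hSm hi, setIntegral_congr_fun hSm
    (g := fun x => Real.exp ε * g x) fun x hx => min_eq_right (le_of_lt hx),
    setIntegral_congr_fun hSm.compl (g := f) fun x hx => min_eq_left (not_lt.1 hx),
    integral_const_mul, ← hg.real_apply hSm, ← hf.real_apply hSm.compl,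
    probReal_compl_eq_one_sub hSm]
  linarith [h S hSm]

/-- Two mutually `(ε, δ)`-indistinguishable laws contain parts `u ≤ f` and `v ≤ g` whose densities
agree up to the factor `exp ε` and where `u` has mass at least `1 - δ`. In addition `u` has at most
the mass of `v`, which is what the bound on the moments of `u / v` requires. -/
theorem exists_pure_parts {P Q μ : Measure X} [IsProbabilityMeasure P] [IsProbabilityMeasure Q]
    {f g : X → ℝ} {ε δ : ℝ} (hε : 0 ≤ ε) (hPQ : Indist P Q ε δ) (hQP : Indist Q P ε δ)
    (hf : IsDensity P μ f) (hg : IsDensity Q μ g) :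
    ∃ u v : X → ℝ, Integrable u μ ∧ Integrable v μ ∧ (∀ x, 0 ≤ u x) ∧ (∀ x, u x ≤ f x) ∧
      (∀ x, v x ≤ g x) ∧ (∀ x, u x ≤ Real.exp ε * v x) ∧ (∀ x, v x ≤ Real.exp ε * u x) ∧
      1 - δ ≤ ∫ x, u x ∂μ ∧ ∫ x, u x ∂μ ≤ ∫ x, v x ∂μ := by
  have ha : 1 ≤ Real.exp ε := Real.one_le_exp hε
  have ha' : (Real.exp ε)⁻¹ ≤ 1 := inv_le_one_of_one_le₀ ha
  have hai : 0 < (Real.exp ε)⁻¹ := by positivity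
  have hh := hPQ.one_sub_le_integral_min hf hg
  have hk := hQP.one_sub_le_integral_min hg hf
  generalize Real.exp ε = a at *
  set h : X → ℝ := fun x => min (f x) (a * g x) with hh_def
  set k : X → ℝ := fun x => min (g x) (a * f x) with hk_def
  have hhi : Integrable h μ := hf.integrable.inf (hg.integrable.const_mul _)
  have hki : Integrable k μ := hg.integrable.inf (hf.integrable.const_mul _)
  have hf0 := hf.nonneg
  have hg0 := hg.nonneg
  have hh0 : ∀ x, 0 ≤ h x := fun x => le_min (hf0 x) (mul_nonneg (by linarith) (hg0 x))
  have hk0 : ∀ x, 0 ≤ k x := fun x => le_min (hg0 x) (mul_nonneg (by linarith) (hf0 x))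
  have hhk : ∀ x, h x ≤ a * k x := fun x => by
    simp only [hk_def]
    rw [mul_min_of_nonneg _ _ (by linarith : 0 ≤ a)]
    refine le_min (min_le_right _ _) ((min_le_left _ _).trans ?_)
    nlinarith [hf0 x, mul_nonneg (sub_nonneg.2 ha) (hf0 x)]
  have hkh : ∀ x, k x ≤ a * h x := fun x => by
    simp only [hh_def]
    rw [mul_min_of_nonneg _ _ (by linarith : 0 ≤ a)]
    refine le_min (min_le_right _ _) ((min_le_left _ _).trans ?_)
    nlinarith [hg0 x, mul_nonneg (sub_nonneg.2 ha) (hg0 x)]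
  have hkh' : ∀ x, a⁻¹ * k x ≤ h x := fun x => by
    rw [inv_mul_le_iff₀ (by linarith)]; exact hkh x
  rcases le_or_gt (∫ x, h x ∂μ) (∫ x, k x ∂μ) with hle | hlt
  · exact ⟨h, k, hhi, hki, hh0, fun x => min_le_left _ _, fun x => min_le_left _ _, hhk, hkh,
      hh, hle⟩
  · -- If `h` is heavier than `k`, lower it towards its smallest admissible value `a⁻¹ * k` until
    -- the masses agree.
    have hb0 : 0 ≤ ∫ x, k x ∂μ := integral_nonneg hk0
    set A := ∫ x, h x ∂μ
    set B := ∫ x, k x ∂μ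
    have hcB : a⁻¹ * B ≤ B := by nlinarith
    have hD : 0 < A - a⁻¹ * B := by linarith
    -- The weight for which the mixture of `h` and `a⁻¹ * k`, of masses
    -- `A > B ≥ a⁻¹ * B`, has mass `B`.
    set t := (B - a⁻¹ * B) / (A - a⁻¹ * B) with ht
    have ht0 : 0 ≤ t := div_nonneg (by linarith) hD.le
    have ht1 : t ≤ 1 := (div_le_one hD).2 (by linarith)
    have hint : ∫ x, (t * h x + (1 - t) * (a⁻¹ * k x)) ∂μ = B := by
      rw [integral_add (hhi.const_mul _) ((hki.const_mul _).const_mul _), integral_const_mul,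
        integral_const_mul, integral_const_mul]
      have : t * (A - a⁻¹ * B) = B - a⁻¹ * B := div_mul_cancel₀ _ hD.ne'
      linarith
    have huh : ∀ x, t * h x + (1 - t) * (a⁻¹ * k x) ≤ h x := fun x => by
      nlinarith [hkh' x]
    have hku : ∀ x, a⁻¹ * k x ≤ t * h x + (1 - t) * (a⁻¹ * k x) := fun x => by
      nlinarith [hkh' x]
    refine ⟨fun x => t * h x + (1 - t) * (a⁻¹ * k x), k,
      (hhi.const_mul _).add ((hki.const_mul _).const_mul _), hki,
      fun x => (mul_nonneg hai.le (hk0 x)).trans (hku x),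
      fun x => (huh x).trans (min_le_left _ _), fun x => min_le_left _ _,
      fun x => (huh x).trans (hhk x), fun x => ?_, hint.symm ▸ hk, hint.le⟩
    have := hku x
    rwa [inv_mul_le_iff₀ (by linarith)] at this

/-- A pointwise bound on products of truncated densities gives a bound on product measures. The
truncation from `f` to `u` costs `1 - (1 - δ) ^ card ι ≤ card ι * δ`, by Bernoulli's inequality. -/
theorem pi_real_le_of_prod_le {ι : Type*} [Fintype ι] {P Q μ : Measure X} [IsProbabilityMeasure P]
    [IsProbabilityMeasure Q] [IsFiniteMeasure μ] {f g u v w : X → ℝ} {δ A B : ℝ}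
    (hδ1 : δ ≤ 1) (hf : IsDensity P μ f) (hg : IsDensity Q μ g)
    (hui : Integrable u μ) (hwi : Integrable w μ) (hu0 : ∀ x, 0 ≤ u x) (huf : ∀ x, u x ≤ f x)
    (hv0 : ∀ x, 0 ≤ v x) (hvg : ∀ x, v x ≤ g x) (hw0 : ∀ x, 0 ≤ w x) (hA : 0 ≤ A) (hB : 0 ≤ B)
    (hδu : 1 - δ ≤ ∫ x, u x ∂μ)
    (hprod : ∀ x : ι → X, ∏ i, u (x i) ≤ A * ∏ i, v (x i) + B * ∏ i, w (x i))
    {E : Set (ι → X)} (hE : MeasurableSet E) :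
    (Measure.pi fun _ => P).real E ≤ A * (Measure.pi fun _ => Q).real E +
      (Fintype.card ι * δ + B * (∫ x, w x ∂μ) ^ Fintype.card ι) := by
  have hF := hf.pi (ι := ι)
  have hG := hg.pi (ι := ι)
  have hU : Integrable (fun x : ι → X => ∏ i, u (x i)) (Measure.pi fun _ => μ) :=
    Integrable.fintype_prod fun _ => hui
  have hW : Integrable (fun x : ι → X => ∏ i, w (x i)) (Measure.pi fun _ => μ) :=
    Integrable.fintype_prod fun _ => hwi
  have hUF : ∀ x : ι → X, ∏ i, u (x i) ≤ ∏ i, f (x i) := fun x =>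
    Finset.prod_le_prod (fun i _ => hu0 _) fun i _ => huf _
  have hVG : ∀ x : ι → X, ∏ i, v (x i) ≤ ∏ i, g (x i) := fun x =>
    Finset.prod_le_prod (fun i _ => hv0 _) fun i _ => hvg _
  have hW0 : ∀ x : ι → X, 0 ≤ ∏ i, w (x i) := fun x => Finset.prod_nonneg fun i _ => hw0 _
  have h1 : ∫ x in E, (∏ i, f (x i) - ∏ i, u (x i)) ∂(Measure.pi fun _ => μ) ≤
      Fintype.card ι * δ := by
    refine (setIntegral_le_integral (hF.integrable.sub hU)
      (Filter.Eventually.of_forall fun x => sub_nonneg.2 (hUF x))).trans ?_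
    simp only [Pi.sub_apply]
    rw [integral_sub hF.integrable hU, hF.integral_eq_one, integral_fintype_prod_eq_pow]
    have hb : 1 + (Fintype.card ι : ℝ) * -δ ≤ (1 + -δ) ^ Fintype.card ι :=
      one_add_mul_le_pow (by linarith) _
    have hp : (1 + -δ) ^ Fintype.card ι ≤ (∫ x, u x ∂μ) ^ Fintype.card ι :=
      pow_le_pow_left₀ (by linarith) (by linarith) _
    linarith
  have h2 : ∫ x in E, ∏ i, u (x i) ∂(Measure.pi fun _ => μ) ≤
      ∫ x in E, (A * ∏ i, g (x i) + B * ∏ i, w (x i)) ∂(Measure.pi fun _ => μ) := by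
    refine setIntegral_mono hU.integrableOn
      ((hG.integrable.const_mul A).add (hW.const_mul B)).integrableOn fun x => ?_
    exact (hprod x).trans (add_le_add_left (mul_le_mul_of_nonneg_left (hVG x) hA) _)
  have h3 : ∫ x in E, ∏ i, w (x i) ∂(Measure.pi fun _ => μ) ≤
      (∫ x, w x ∂μ) ^ Fintype.card ι := by
    rw [← integral_fintype_prod_eq_pow (ι := ι)]
    exact setIntegral_le_integral hW (Filter.Eventually.of_forall hW0)
  rw [integral_sub hF.integrable.integrableOn hU.integrableOn, ← hF.real_apply hE] at h1
  rw [integral_add (hG.integrable.const_mul A).integrableOn (hW.const_mul B).integrableOn,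
    integral_const_mul, integral_const_mul, ← hG.real_apply hE] at h2
  linarith [mul_le_mul_of_nonneg_left h3 hB]

/-- Basic composition of independent copies. -/
theorem Indist.pi {ι : Type*} [Fintype ι] {P Q : Measure X} [IsProbabilityMeasure P]
    [IsProbabilityMeasure Q] {ε δ : ℝ} (hε : 0 ≤ ε) (hδ1 : δ ≤ 1)
    (hPQ : Indist P Q ε δ) (hQP : Indist Q P ε δ) :
    Indist (Measure.pi fun _ : ι => P) (Measure.pi fun _ : ι => Q)
      (Fintype.card ι * ε) (Fintype.card ι * δ) := by
  obtain ⟨μ, f, g, hμ, hf, hg⟩ := exists_common_density P Q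
  obtain ⟨u, v, hui, -, hu0, huf, hvg, huv, hvu, hδu, -⟩ := exists_pure_parts hε hPQ hQP hf hg
  intro E hE
  have hv0 : ∀ x, 0 ≤ v x := fun x =>
    nonneg_of_mul_nonneg_right ((hu0 x).trans (huv x)) (Real.exp_pos ε)
  have := pi_real_le_of_prod_le (ι := ι) (A := Real.exp (Fintype.card ι * ε)) (B := 0) (w := 0)
    hδ1 hf hg hui (integrable_zero _ _ _) hu0 huf hv0 hvg (fun _ => le_rfl) (Real.exp_pos _).le
    le_rfl hδu (fun x => ?_) hE
  · simpa using this
  · rw [zero_mul, add_zero, Real.exp_nat_mul, ← Finset.card_univ, ← Finset.prod_const,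
      ← Finset.prod_mul_distrib]
    exact Finset.prod_le_prod (fun i _ => hu0 _) fun i _ => huv _

/-- Advanced composition of independent copies. The mean privacy loss of each copy is bounded by
`ε * (exp ε - 1) / (exp ε + 1)`, its value for randomized response, and Hoeffding's lemma controls
the fluctuation of the sum. -/
theorem Indist.pi_advanced {ι : Type*} [Fintype ι] [Nonempty ι] {P Q : Measure X}
    [IsProbabilityMeasure P] [IsProbabilityMeasure Q] {ε δ δ'' : ℝ} (hε : 0 ≤ ε) (hδ0 : 0 ≤ δ)
    (hδ1 : δ ≤ 1) (hδ'' : 0 < δ'') (hPQ : Indist P Q ε δ) (hQP : Indist Q P ε δ) :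
    Indist (Measure.pi fun _ : ι => P) (Measure.pi fun _ : ι => Q)
      (ε * (Real.sqrt (2 * Fintype.card ι * Real.log (1 / δ'')) +
        Fintype.card ι * ((Real.exp ε - 1) / (Real.exp ε + 1))))
      (Fintype.card ι * δ + δ'') := by
  have hT : (0 : ℝ) < Fintype.card ι := by exact_mod_cast Fintype.card_pos
  -- For `δ'' > 1` the logarithm is negative and the square root is `0`, but the bound is trivial.
  rcases lt_or_ge 1 δ'' with hbig | hsmall
  · intro E _
    have h1 : (Measure.pi fun _ : ι => P).real E ≤ 1 := measureReal_le_one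
    have h2 := mul_nonneg (Real.exp_pos (ε * (Real.sqrt (2 * Fintype.card ι * Real.log (1 / δ'')) +
        Fintype.card ι * ((Real.exp ε - 1) / (Real.exp ε + 1))))).le
      (measureReal_nonneg (μ := Measure.pi fun _ : ι => Q) (s := E))
    have h3 := mul_nonneg hT.le hδ0
    linarith
  -- For `ε = 0` the optimal Chernoff parameter below degenerates; basic composition suffices.
  rcases hε.eq_or_lt with rfl | hε
  · intro E hE
    have := Indist.pi (ι := ι) le_rfl hδ1 hPQ hQP E hE
    simp only [mul_zero, zero_mul] at this ⊢
    linarith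
  obtain ⟨μ, f, g, hμ, hf, hg⟩ := exists_common_density P Q
  obtain ⟨u, v, hui, hvi, hu0, huf, hvg, huv, hvu, hδu, hle⟩ :=
    exists_pure_parts hε.le hPQ hQP hf hg
  intro E hE
  have hv0 : ∀ x, 0 ≤ v x := fun x =>
    nonneg_of_mul_nonneg_right ((hu0 x).trans (huv x)) (Real.exp_pos ε)
  have ha : 1 < Real.exp ε := Real.one_lt_exp_iff.2 hε
  set L := Real.log (1 / δ'') with hL
  have hL0 : 0 ≤ L := Real.log_nonneg (by rw [le_div_iff₀ hδ'']; linarith)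
  set s := Real.sqrt (2 * Fintype.card ι * L) with hs
  have hs2 : s ^ 2 = 2 * Fintype.card ι * L := Real.sq_sqrt (by positivity)
  set κ := (Real.exp ε - 1) / (Real.exp ε + 1) with hκ
  -- The minimizer of the Chernoff exponent `-l * ε * s + card ι * (l * ε) ^ 2 / 2`; the minimum
  -- is `-L`.
  set l := s / (Fintype.card ι * ε) with hl
  have hl0 : 0 ≤ l := by positivity
  have hlε : l * ε * Fintype.card ι = s := by rw [hl]; field_simp
  set c := ε * (s + Fintype.card ι * κ) with hc
  have hwi : Integrable (fun x => rpowChord (Real.exp ε) (1 + l) (u x) (v x)) μ :=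
    ((((hvi.const_mul _).sub hui).mul_const _).add
      ((hui.sub (hvi.const_mul _)).mul_const _)).div_const _
  have hw0 : ∀ x, 0 ≤ rpowChord (Real.exp ε) (1 + l) (u x) (v x) := fun x =>
    rpowChord_nonneg ha (huv x) (hvu x)
  have hwint : ∫ x, rpowChord (Real.exp ε) (1 + l) (u x) (v x) ∂μ ≤
      Real.exp (l * ε * κ + (l * ε) ^ 2 / 2) := by
    have e : ∫ x, rpowChord (Real.exp ε) (1 + l) (u x) (v x) ∂μ =
        rpowChord (Real.exp ε) (1 + l) (∫ x, u x ∂μ) (∫ x, v x ∂μ) := by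
      have i1 : Integrable (fun x => Real.exp ε * v x) μ := hvi.const_mul _
      have i2 : Integrable (fun x => (Real.exp ε)⁻¹ * v x) μ := hvi.const_mul _
      have i3 : Integrable (fun x => (Real.exp ε * v x - u x) * (Real.exp ε)⁻¹ ^ (1 + l)) μ :=
        (i1.sub hui).mul_const _
      have i4 : Integrable (fun x => (u x - (Real.exp ε)⁻¹ * v x) * Real.exp ε ^ (1 + l)) μ :=
        (hui.sub i2).mul_const _
      simp only [rpowChord]
      rw [integral_div, integral_add i3 i4, integral_mul_const, integral_mul_const,
        integral_sub i1 hui, integral_sub hui i2, integral_const_mul, integral_const_mul]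
    have hu1 : ∫ x, u x ∂μ ≤ 1 := hf.integral_eq_one ▸ integral_mono hui hf.integrable huf
    have h11 : 0 ≤ rpowChord (Real.exp ε) (1 + l) 1 1 :=
      rpowChord_nonneg ha (by linarith) (by linarith)
    calc _ ≤ rpowChord (Real.exp ε) (1 + l) (∫ x, u x ∂μ) (∫ x, u x ∂μ) :=
          e.trans_le (rpowChord_antitone ha (by linarith) hle)
      _ = (∫ x, u x ∂μ) * rpowChord (Real.exp ε) (1 + l) 1 1 := by
          simp only [rpowChord]; ring
      _ ≤ rpowChord (Real.exp ε) (1 + l) 1 1 := mul_le_of_le_one_left h11 hu1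
      _ ≤ _ := rpowChord_exp_one_one_le hε
  have h := pi_real_le_of_prod_le (ι := ι) hδ1 hf hg hui hwi hu0 huf hv0 hvg hw0
    (Real.exp_pos c).le (Real.exp_pos (-(l * c))).le hδu
    (fun x => prod_le_exp_mul_prod_add ha hl0 (fun i => hu0 (x i)) (fun i => huv (x i))
      fun i => hvu (x i)) hE
  have htail : Real.exp (-(l * c)) *
      (∫ x, rpowChord (Real.exp ε) (1 + l) (u x) (v x) ∂μ) ^ Fintype.card ι ≤ δ'' := by
    calc _ ≤ Real.exp (-(l * c)) *
          Real.exp (l * ε * κ + (l * ε) ^ 2 / 2) ^ Fintype.card ι := by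
          gcongr
          exact integral_nonneg hw0
      _ = Real.exp (-L) := by
          rw [← Real.exp_nat_mul, ← Real.exp_add]
          congr 1
          have h3 : l * ε * s = 2 * L := by
            have : l * ε * s * Fintype.card ι = 2 * L * Fintype.card ι := by
              calc _ = l * ε * Fintype.card ι * s := by ring
                _ = s ^ 2 := by rw [hlε]; ring
                _ = _ := by rw [hs2]; ring
            exact mul_right_cancel₀ hT.ne' this
          have h4 : (l * ε) ^ 2 * Fintype.card ι = 2 * L := by
            calc _ = l * ε * (l * ε * Fintype.card ι) := by ring
              _ = _ := by rw [hlε, h3]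
          rw [hc]
          linear_combination -h3 + h4 / 2
      _ = δ'' := by rw [hL, one_div, Real.log_inv, neg_neg, Real.exp_log hδ'']
  linarith

/-! ### Amplification by subsampling -/

section Subsampling
variable {n m : ℕ}

open Classical in
/-- Double counting of the pairs `(I, k)` with `j` in and `k` not in the tuple `I`. Replacing `j` by
`k` turns them bijectively into the pairs with `k` in and `j` not in the tuple; so if each
replacement costs at most a factor `a` and an error `d`, the tuples through `j` are compared with
the tuples avoiding `j`. -/
theorem sum_range_compl_le {j : Fin n} {F : (Fin m ↪ Fin n) → ℝ} {a d : ℝ}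
    (hF : ∀ (I : Fin m ↪ Fin n) (k : Fin n), j ∈ Set.range I → k ∉ Set.range I →
      F I ≤ a * F (I.trans (Equiv.swap j k).toEmbedding) + d) :
    ((n : ℝ) - m) * ∑ I ∈ Finset.univ.filter (fun I : Fin m ↪ Fin n => j ∈ Set.range I), F I ≤
      a * (m * ∑ I ∈ Finset.univ.filter (fun I : Fin m ↪ Fin n => j ∉ Set.range I), F I) +
        d * (((n : ℝ) - m) *
          (Finset.univ.filter fun I : Fin m ↪ Fin n => j ∈ Set.range I).card) := by
  have hcardR : ∀ I : Fin m ↪ Fin n,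
      ((Finset.univ.filter fun k => k ∈ Set.range I).card : ℝ) = m := by
    intro I
    have : (Finset.univ.filter fun k => k ∈ Set.range I) = Finset.univ.map I := by
      ext k; simp
    rw [this, Finset.card_map]; simp
  have hcardC : ∀ I : Fin m ↪ Fin n,
      ((Finset.univ.filter fun k => k ∉ Set.range I).card : ℝ) = n - m := by
    intro I
    have := Finset.card_filter_add_card_filter_not (s := (Finset.univ : Finset (Fin n)))
      (fun k => k ∈ Set.range I)
    rw [← hcardR I, eq_sub_iff_add_eq, add_comm]
    exact_mod_cast by simpa using this
  have hswap : ∀ k : Fin n,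
      ∑ I ∈ Finset.univ.filter (fun I : Fin m ↪ Fin n => j ∈ Set.range I ∧ k ∉ Set.range I),
        F (I.trans (Equiv.swap j k).toEmbedding) =
      ∑ I ∈ Finset.univ.filter (fun I : Fin m ↪ Fin n => j ∉ Set.range I ∧ k ∈ Set.range I), F I := by
    intro k
    have hr : ∀ (I : Fin m ↪ Fin n) (i : Fin n),
        i ∈ Set.range (I.trans (Equiv.swap j k).toEmbedding) ↔
          Equiv.swap j k i ∈ Set.range I := by
      intro I i
      simp only [Set.mem_range, Function.Embedding.trans_apply, Equiv.coe_toEmbedding]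
      exact exists_congr fun x => by
        rw [Equiv.swap_apply_eq_iff]
    refine Finset.sum_nbij' (fun I => I.trans (Equiv.swap j k).toEmbedding)
      (fun I => I.trans (Equiv.swap j k).toEmbedding) ?_ ?_ ?_ ?_ ?_
    · intro I hI
      simp only [Finset.mem_filter, Finset.mem_univ, true_and, hr, Equiv.swap_apply_left,
        Equiv.swap_apply_right] at hI ⊢
      exact hI.symm
    · intro I hI
      simp only [Finset.mem_filter, Finset.mem_univ, true_and, hr, Equiv.swap_apply_left,
        Equiv.swap_apply_right] at hI ⊢
      exact hI.symm
    · intro I _; ext x; simp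
    · intro I _; ext x; simp
    · intro I _; rfl
  have hL : ((n : ℝ) - m) *
      ∑ I ∈ Finset.univ.filter (fun I : Fin m ↪ Fin n => j ∈ Set.range I), F I =
      ∑ k : Fin n,
        ∑ I ∈ Finset.univ.filter (fun I : Fin m ↪ Fin n => j ∈ Set.range I ∧ k ∉ Set.range I), F I := by
    simp_rw [← Finset.filter_filter]
    simp_rw [Finset.sum_filter (fun I : Fin m ↪ Fin n => _ ∉ Set.range I)]
    rw [Finset.sum_comm, Finset.mul_sum]
    refine Finset.sum_congr rfl fun I _ => ?_
    rw [← Finset.sum_filter, Finset.sum_const, nsmul_eq_mul, hcardC]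
  have hR : (m : ℝ) * ∑ I ∈ Finset.univ.filter (fun I : Fin m ↪ Fin n => j ∉ Set.range I), F I =
      ∑ k : Fin n,
        ∑ I ∈ Finset.univ.filter (fun I : Fin m ↪ Fin n => j ∉ Set.range I ∧ k ∈ Set.range I), F I := by
    simp_rw [← Finset.filter_filter]
    simp_rw [Finset.sum_filter (fun I : Fin m ↪ Fin n => _ ∈ Set.range I)]
    rw [Finset.sum_comm, Finset.mul_sum]
    refine Finset.sum_congr rfl fun I _ => ?_
    rw [← Finset.sum_filter, Finset.sum_const, nsmul_eq_mul, hcardR]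
  have hD : ((n : ℝ) - m) * (Finset.univ.filter fun I : Fin m ↪ Fin n => j ∈ Set.range I).card =
      ∑ k : Fin n,
        ∑ I ∈ Finset.univ.filter (fun I : Fin m ↪ Fin n => j ∈ Set.range I ∧ k ∉ Set.range I), (1 : ℝ) := by
    simp_rw [← Finset.filter_filter]
    simp_rw [Finset.sum_filter (fun I : Fin m ↪ Fin n => _ ∉ Set.range I)]
    rw [Finset.sum_comm, Finset.card_eq_sum_ones, Nat.cast_sum, Finset.mul_sum]
    refine Finset.sum_congr rfl fun I _ => ?_
    rw [← Finset.sum_filter, Finset.sum_const, nsmul_eq_mul, hcardC]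
    simp
  rw [hL, hR, hD]
  simp_rw [← hswap]
  rw [Finset.mul_sum, Finset.mul_sum, ← Finset.sum_add_distrib]
  refine Finset.sum_le_sum fun k _ => ?_
  rw [Finset.mul_sum, Finset.mul_sum, ← Finset.sum_add_distrib]
  refine Finset.sum_le_sum fun I hI => ?_
  simp only [Finset.mem_filter, Finset.mem_univ, true_and] at hI
  rw [mul_one]
  exact hF I k hI.1 hI.2

open Classical in
/-- A uniformly random tuple of `m` distinct indices contains `j` with probability `m / n`. -/
theorem card_filter_mem_range (j : Fin n) :
    (n : ℝ) * (Finset.univ.filter fun I : Fin m ↪ Fin n => j ∈ Set.range I).card =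
      m * Fintype.card (Fin m ↪ Fin n) := by
  have hsym : ∀ k : Fin n, (Finset.univ.filter fun I : Fin m ↪ Fin n => k ∈ Set.range I).card =
      (Finset.univ.filter fun I : Fin m ↪ Fin n => j ∈ Set.range I).card := by
    intro k
    refine Finset.card_nbij' (fun I => I.trans (Equiv.swap j k).toEmbedding)
      (fun I => I.trans (Equiv.swap j k).toEmbedding) ?_ ?_ ?_ ?_
    · intro I hI
      obtain ⟨x, hx⟩ : k ∈ Set.range I := by simpa using hI
      simp only [Finset.coe_filter, Finset.mem_univ, true_and, Set.mem_ofPred_eq]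
      exact ⟨x, by simp [hx]⟩
    · intro I hI
      obtain ⟨x, hx⟩ : j ∈ Set.range I := by simpa using hI
      simp only [Finset.coe_filter, Finset.mem_univ, true_and, Set.mem_ofPred_eq]
      exact ⟨x, by simp [hx]⟩
    · intro I _; ext x; simp
    · intro I _; ext x; simp
  have h : ∑ k : Fin n, (Finset.univ.filter fun I : Fin m ↪ Fin n => k ∈ Set.range I).card =
      ∑ _I : Fin m ↪ Fin n, m := by
    simp_rw [Finset.card_filter]
    rw [Finset.sum_comm]
    refine Finset.sum_congr rfl fun I _ => ?_
    rw [← Finset.card_filter]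
    have : (Finset.univ.filter fun k => k ∈ Set.range I) = Finset.univ.map I := by
      ext k; simp
    rw [this, Finset.card_map]; simp
  rw [Finset.sum_congr rfl fun k _ => hsym k] at h
  simp only [Finset.sum_const, Finset.card_univ, Fintype.card_fin, smul_eq_mul] at h
  rw [mul_comm (m : ℝ)]
  exact_mod_cast h

theorem subsampled_real {Ω R : Type*} [MeasurableSpace R] (hmn : m ≤ n) (M : Mechanism Ω m R)
    (ω : Fin n → Ω) (E : Set R) :
    (subsampled hmn M ω : Measure R).real E =
      (Fintype.card (Fin m ↪ Fin n) : ℝ)⁻¹ *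
        ∑ I : Fin m ↪ Fin n, (M (ω ∘ I) : Measure R).real E := by
  simp only [subsampled, measureReal_def, ProbabilityMeasure.coe_mk, Measure.smul_apply,
    Measure.coe_finsetSum, Finset.sum_apply, smul_eq_mul, ENNReal.toReal_mul, ENNReal.toReal_inv,
    ENNReal.toReal_natCast]
  rw [ENNReal.toReal_sum fun I _ => measure_ne_top _ _]

theorem exp_epsAmp {ε' : ℝ} (hε' : 0 ≤ ε') :
    Real.exp (epsAmp n m ε') = 1 + (m : ℝ) / n * (Real.exp ε' - 1) := by
  have : 0 ≤ Real.exp ε' - 1 := sub_nonneg.2 (Real.one_le_exp hε')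
  exact Real.exp_log (by positivity)

theorem epsAmp_nonneg {ε' : ℝ} (hε' : 0 ≤ ε') : 0 ≤ epsAmp n m ε' := by
  have : 0 ≤ Real.exp ε' - 1 := sub_nonneg.2 (Real.one_le_exp hε')
  exact Real.log_nonneg (le_add_of_nonneg_right (by positivity))

theorem neighbors_comp_of_ne {Ω : Type*} {ω ω' : Fin n → Ω} {j : Fin n}
    (h : ∀ i, i ≠ j → ω i = ω' i) (I : Fin m ↪ Fin n) (hj : j ∈ Set.range I) :
    Neighbors (ω ∘ I) (ω' ∘ I) := by
  obtain ⟨x, rfl⟩ := hj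
  exact ⟨x, fun i hi => h _ (I.injective.ne hi)⟩

/-- Replacing one sampled index by an unsampled one yields a neighbouring subsample. -/
theorem neighbors_comp_swap {Ω : Type*} (ω : Fin n → Ω) {j k : Fin n} (I : Fin m ↪ Fin n)
    (hj : j ∈ Set.range I) (hk : k ∉ Set.range I) :
    Neighbors (ω ∘ I) (ω ∘ I.trans (Equiv.swap j k).toEmbedding) := by
  obtain ⟨x, rfl⟩ := hj
  refine ⟨x, fun i hi => ?_⟩
  simp only [Function.comp, Function.Embedding.trans_apply, Equiv.coe_toEmbedding]
  rw [Equiv.swap_apply_of_ne_of_ne (I.injective.ne hi) fun h => hk ⟨i, h⟩]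

/-- Privacy amplification by subsampling without replacement. The tuples through the changed index
`j` are compared both with themselves under `ω'` and with the tuples avoiding `j`, where `ω` and
`ω'` agree; the better of the two comparisons gives the claim. -/
theorem IsDP.subsampled {Ω R : Type*} [MeasurableSpace R] (hmn : m ≤ n) {M : Mechanism Ω m R}
    {ε' δ' : ℝ} (hε' : 0 ≤ ε') (hM : IsDP M ε' δ') :
    IsDP (subsampled hmn M) (epsAmp n m ε') (deltaAmp n m δ') := by
  classical
  rintro ω ω' ⟨j, hj⟩ E hE
  have hn : (0 : ℝ) < n := by exact_mod_cast j.pos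
  have hne : Nonempty (Fin m ↪ Fin n) := ⟨Fin.castLEEmb hmn⟩
  have hN : (0 : ℝ) < Fintype.card (Fin m ↪ Fin n) := by exact_mod_cast Fintype.card_pos
  have he : 1 ≤ Real.exp ε' := Real.one_le_exp hε'
  rw [exp_epsAmp hε', deltaAmp, subsampled_real, subsampled_real]
  set F : (Fin m ↪ Fin n) → ℝ := fun I => (M (ω ∘ I) : Measure R).real E with hF
  set G : (Fin m ↪ Fin n) → ℝ := fun I => (M (ω' ∘ I) : Measure R).real E with hG
  have hcard := card_filter_mem_range (m := m) j
  have hswap := sum_range_compl_le (j := j) (F := F) (a := Real.exp ε') (d := δ')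
    fun I k hI hk => hM _ _ (neighbors_comp_swap ω I hI hk) E hE
  have hmem :
      ∑ I ∈ Finset.univ.filter (fun I : Fin m ↪ Fin n => j ∈ Set.range I), F I ≤
      Real.exp ε' * ∑ I ∈ Finset.univ.filter (fun I : Fin m ↪ Fin n => j ∈ Set.range I), G I +
      δ' * (Finset.univ.filter fun I : Fin m ↪ Fin n => j ∈ Set.range I).card := by
    calc _ ≤ ∑ I ∈ Finset.univ.filter (fun I : Fin m ↪ Fin n => j ∈ Set.range I),
          (Real.exp ε' * G I + δ') :=
          Finset.sum_le_sum fun I hI =>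
            hM _ _ (neighbors_comp_of_ne hj I (by simpa using hI)) E hE
      _ = _ := by
          rw [Finset.sum_add_distrib, Finset.mul_sum, Finset.sum_const, nsmul_eq_mul, mul_comm δ']
  have hcompl :
      ∑ I ∈ Finset.univ.filter (fun I : Fin m ↪ Fin n => j ∉ Set.range I), F I =
      ∑ I ∈ Finset.univ.filter (fun I : Fin m ↪ Fin n => j ∉ Set.range I), G I := by
    refine Finset.sum_congr rfl fun I hI => ?_
    have hI' : j ∉ Set.range I := by simpa using hI
    have : ω ∘ I = ω' ∘ I := funext fun i => hj _ fun h => hI' ⟨i, h⟩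
    simp only [hF, hG, this]
  rw [← Finset.sum_filter_add_sum_filter_not Finset.univ (fun I : Fin m ↪ Fin n => j ∈ Set.range I) F,
    ← Finset.sum_filter_add_sum_filter_not Finset.univ (fun I : Fin m ↪ Fin n => j ∈ Set.range I) G,
    hcompl]
  rw [hcompl] at hswap
  generalize ∑ I ∈ Finset.univ.filter (fun I : Fin m ↪ Fin n => j ∈ Set.range I), F I = A at *
  generalize ∑ I ∈ Finset.univ.filter (fun I : Fin m ↪ Fin n => j ∈ Set.range I), G I = A' at *
  generalize ∑ I ∈ Finset.univ.filter (fun I : Fin m ↪ Fin n => j ∉ Set.range I), G I = B at *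
  generalize ((Finset.univ.filter fun I : Fin m ↪ Fin n => j ∈ Set.range I).card : ℝ) = K at *
  generalize (Fintype.card (Fin m ↪ Fin n) : ℝ) = N at *
  generalize Real.exp ε' = e at *
  have h1 : (m : ℝ) * A ≤ e * (m * A') + δ' * (m * K) := by
    have := mul_le_mul_of_nonneg_left hmem (Nat.cast_nonneg (α := ℝ) m)
    linarith
  have h2 : n * A ≤ (n : ℝ) * A' + m * (e - 1) * (A' + B) + δ' * (n * K) := by
    have hsum : (n : ℝ) * A ≤ e * (m * (A' + B)) + δ' * (n * K) := by linarith
    have hnmem := mul_le_mul_of_nonneg_left hmem hn.le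
    have he' : 0 ≤ e - 1 := by linarith
    -- Whether the tuples avoiding `j` or the tuples through `j` have the smaller average response
    -- probability under `ω'` decides which comparison to use.
    rcases le_total ((m : ℝ) * (A' + B)) (n * A') with hab | hab
    · linarith
    · linarith [mul_le_mul_of_nonneg_left hab he']
  have h3 : n * (A + B) ≤ (n + m * (e - 1)) * (A' + B) + m * δ' * N := by
    rw [hcard] at h2
    linarith
  calc N⁻¹ * (A + B) = (n * (A + B)) / (n * N) := by field_simp
    _ ≤ ((n + m * (e - 1)) * (A' + B) + m * δ' * N) / (n * N) := by gcongr
    _ = _ := by field_simp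

end Subsampling

end PrivCI

open PrivCI in
theorem theorem3p1 {Ω : Type*} (n m T : ℕ) (hm : 1 ≤ m) (hmn : m ≤ n)
    (hT : 1 ≤ T) (hTn : T ≤ n.choose m)
    (τn τm : ℝ) (hτn : 0 < τn) (hτm : 0 < τm) (α : ℝ) (hα0 : 0 < α) (hα1 : α < 1)
    (ε δ ε' δ' : ℝ) (hε : 0 ≤ ε) (hε' : 0 ≤ ε')
    (hδ : δ ∈ Set.Icc (0 : ℝ) 1) (hδ' : δ' ∈ Set.Icc (0 : ℝ) 1)
    (M : Mechanism Ω n ℝ) (M' : Mechanism Ω m ℝ)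
    (hM : IsDP M ε δ) (hM' : IsDP M' ε' δ') :
    IsDP (privSub hmn hT τn τm α M M')
        (T * epsAmp n m ε' + ε) (T * deltaAmp n m δ' + δ) ∧
      ∀ δ'' : ℝ, 0 < δ'' →
        IsDP (privSub hmn hT τn τm α M M')
          (epsTotal n m T ε ε' δ'') (T * deltaAmp n m δ' + δ'' + δ) := by
  have hS := hM'.subsampled hmn hε'
  have hne : Nonempty (Fin T) := ⟨⟨0, hT⟩⟩
  have hsymm : ∀ {ω ω' : Fin n → Ω}, Neighbors ω ω' → Neighbors ω' ω :=
    fun ⟨j, hj⟩ => ⟨j, fun i hi => (hj i hi).symm⟩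
  have hpn : (m : ℝ) / n ≤ 1 := div_le_one_of_le₀ (by exact_mod_cast hmn) (Nat.cast_nonneg n)
  have hd0 : 0 ≤ deltaAmp n m δ' := mul_nonneg (by positivity) hδ'.1
  have hd1 : deltaAmp n m δ' ≤ 1 := mul_le_one₀ hpn hδ'.1 hδ'.2
  have he0 : 0 ≤ epsAmp n m ε' := epsAmp_nonneg hε'
  refine ⟨fun ω ω' hω => ?_, fun δ'' hδ'' ω ω' hω => ?_⟩
  · have h1 : Indist (M ω : Measure ℝ) (M ω') ε δ := hM ω ω' hω
    have h2 := Indist.pi (ι := Fin T) he0 hd1 (hS ω ω' hω) (hS ω' ω (hsymm hω))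
    rw [Fintype.card_fin] at h2
    exact (h1.prod h2 (by positivity)).map (measurable_interval hT τn τm α)
  · have h1 : Indist (M ω : Measure ℝ) (M ω') ε δ := hM ω ω' hω
    have h2 := Indist.pi_advanced (ι := Fin T) he0 hd0 hd1 hδ'' (hS ω ω' hω) (hS ω' ω (hsymm hω))
    rw [Fintype.card_fin] at h2
    exact (h1.prod h2 (by positivity)).map (measurable_interval hT τn τm α)
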